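/- For a semigroup $S$ let $S^1$ denote $S$ with an identity adjoined if $S$ has none. For $x,y,z_1,z_2,\ldots$ in $S^1$ define $\lambda_0=x$, $\rho_0=y$, $\lambda_{n+1}=\lambda_n z_{n+1}\rho_n$ and $\rho_{n+1}=\rho_n z_{n+1}\lambda_n$, and write $\lambda_n=\lambda_n(x,y,z_1,\ldots,z_n)$, $\rho_n=\rho_n(x,y,z_1,\ldots,z_n)$. The semigroup $S$ is positively Engel if there is $n\ge 2$ such that $\lambda_n(a,b,1,1,c,c^2,\ldots,c^{n-2})=\rho_n(a,b,1,1,c,c^2,\ldots,c^{n-2})$ for all $a,b\in S$ and $c\in S^1$. Let $\mathsf{BG_{nil}}$ be the class of all finite semigroups $S$ in which each element $a$ has at most one inverse (an element $b$ with $aba=a$ and $bab=b$) and all of whose subgroups are nilpotent groups. A semigroup $T$ divides $S$ if $T$ is a homomorphic image of a subsemigroup of $S$. Let $F_7$ be the seven-element semigroup $\{\theta\}\cup\{(1;i,j): 1\le i,j\le 2\}\cup\{1,u\}$ in which $\theta$ is a zero, $\{1,u\}$ is the cyclic group of order $2$ with identity $1$ acting on the indices $\{1,2\}$ with $u$ exchanging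 $1$ and $2$, and $(1;i,j)(1;k,l)=(1;i,l)$ if $j=k$ and $\theta$ otherwise, $(1;i,j)\,g=(1;i,g(j))$, and $g\,(1;i,j)=(1;g^{-1}(i),j)$ for $g\in\{1,u\}$. Theorem. A finite semigroup $S$ is positively Engel if and only if $S\in\mathsf{BG_{nil}}$ and $F_7$ does not divide $S$. -/

import Mathlib

/-- The pair `(λ_n, ρ_n)` of words of Mal'cev in `x`, `y` and the parameters `z 1, z 2, …`
(the value `z 0` is not used): `λ_0 = x`, `ρ_0 = y`, `λ_{n+1} = λ_n z_{n+1} ρ_n` and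
`ρ_{n+1} = ρ_n z_{n+1} λ_n`. -/
def malcevPair {M : Type*} [Mul M] (x y : M) (z : ℕ → M) : ℕ → M × M
  | 0 => (x, y)
  | n + 1 =>
    ((malcevPair x y z n).1 * z (n + 1) * (malcevPair x y z n).2,
      (malcevPair x y z n).2 * z (n + 1) * (malcevPair x y z n).1)

/-- The word `λ_n(x, y, z_1, …, z_n)`. -/
def malcevLambda {M : Type*} [Mul M] (x y : M) (z : ℕ → M) (n : ℕ) : M :=
  (malcevPair x y z n).1

/-- The word `ρ_n(x, y, z_1, …, z_n)`. -/
def malcevRho {M : Type*} [Mul M] (x y : M) (z : ℕ → M) (n : ℕ) : M :=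
  (malcevPair x y z n).2

/-- The parameters `z_1, z_2, z_3, z_4, … = 1, 1, c, c ^ 2, …` (with `z_0 = 1`, not used),
so that `z_n = c ^ (n - 2)` for `n ≥ 2`. -/
def engelParam {M : Type*} [Monoid M] (c : M) : ℕ → M
  | 0 => 1
  | 1 => 1
  | k + 2 => c ^ k

/-- `S` is positively Engel: for some `n ≥ 2`,
`λ_n(a, b, 1, 1, c, c², …, c^{n-2}) = ρ_n(a, b, 1, 1, c, c², …, c^{n-2})` for all `a, b` in `S`
and all `c` in `S` with an identity adjoined. (If `S` already has an identity `e`, then the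
instance `c = 1` of the equation is the same as the instance `c = e`, so adjoining a new identity
in that case changes nothing.) -/
def IsPositivelyEngel (S : Type*) [Semigroup S] : Prop :=
  ∃ n : ℕ, 2 ≤ n ∧ ∀ (a b : S) (c : WithOne S),
    malcevLambda (a : WithOne S) (b : WithOne S) (engelParam c) n =
      malcevRho (a : WithOne S) (b : WithOne S) (engelParam c) n

/-- `b` is an inverse of `a` in the sense of semigroup theory. -/
def IsSemigroupInverse {S : Type*} [Semigroup S] (a b : S) : Prop :=
  a * b * a = a ∧ b * a * b = b

/-- Each element of `S` has at most one inverse. -/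
def IsBlockGroup (S : Type*) [Semigroup S] : Prop :=
  ∀ a b c : S, IsSemigroupInverse a b → IsSemigroupInverse a c → b = c

/-- `S` belongs to `BG_nil`: it is a finite block group and every subgroup of `S` (that is, every
group embedded in `S` by a homomorphism of semigroups) is a nilpotent group. -/
def IsBGnil.{u} (S : Type u) [Semigroup S] : Prop :=
  Finite S ∧ IsBlockGroup S ∧
    ∀ (G : Type u) [Group G] (f : G →ₙ* S), Function.Injective f → Group.IsNilpotent G

/-- `T` divides `S`: it is a homomorphic image of a subsemigroup of `S`. -/
def SemigroupDivides (T S : Type*) [Semigroup T] [Semigroup S] : Prop :=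
  ∃ (U : Subsemigroup S) (f : U →ₙ* T), Function.Surjective f

/-- The seven elements of `F_7`: the zero `θ`, the elements `(1; i, j)` of the Rees matrix
semigroup `M⁰({1}, 2, 2; I₂)`, and the elements `1`, `u` of the cyclic group of order two, which
are given as the permutations `(1)(2)` and `(1, 2)` of the two indices by which they act. -/
inductive F7 : Type
  | theta : F7
  | rees (i j : Fin 2) : F7
  | grp (g : Equiv.Perm (Fin 2)) : F7

namespace F7

/-- The product of `F_7`. The group acts on column indices on the right, `(1; i, j) g = (1; i, g(j))`,
and on row indices on the left, `g (1; i, j) = (1; i', j)` where `g(i') = i`. -/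
def mul : F7 → F7 → F7
  | rees i j, rees k l => if j = k then rees i l else theta
  | rees i j, grp g => rees i (g j)
  | grp g, rees i j => rees (g.symm i) j
  | grp g, grp h => grp (g.trans h)
  | theta, _ => theta
  | _, theta => theta

instance : Semigroup F7 where
  mul := mul
  mul_assoc a b c := by
    change mul (mul a b) c = mul a (mul b c)
    rcases a with _ | ⟨i, j⟩ | g <;> rcases b with _ | ⟨k, l⟩ | h <;>
      rcases c with _ | ⟨p, q⟩ | r <;> simp only [mul] <;>
      (try split_ifs) <;> simp_all [Equiv.trans_assoc, Equiv.eq_symm_apply]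

end F7

/-! ### Positively Engel semigroups: subsemigroups, images, divisors -/

/-! Necessity. For fixed `n` the identity passes to divisors. It fails in left zero and right zero
pairs, which forces a block group, and it fails in `F7`. For groups, a minimal counterexample has
nilpotent proper subgroups, hence a proper nontrivial normal subgroup
(`exists_normal_of_not_isNilpotent`) and so an elementary abelian normal `p`-subgroup. Taking `b =
c⁻¹` in the identity makes every element act unipotently there. The action is that of a `p`-group,
so it fixes a nontrivial point; the center is nontrivial and induction applies to the quotient by
it.

Sufficiency. For fixed `a, b, c` in a finite semigroup the pairs `(λ_n, ρ_n)` are eventually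
periodic. On the cycle the entries `A`, `B` are regular. In a block group the idempotent on the left
of `A` stays a constant `i`, that of `B` a constant `k`, while the two right idempotents swap at
each step. Comparing two consecutive steps shows that `c` sends `i` to `k` and `k` to `i` in the
partial action `Moves`. If `i ≠ k`, the elements acting on `{i, k}` by partial injections map onto
`F7`, which is the semigroup of all partial injections of two points. If `i = k`, the cycle lives in
the maximal subgroup at `i`, where nilpotency forces `A n = B n` (`MalcevCycle.exists_eq`). -/

theorem malcevPair_map {M N : Type*} [Mul M] [Mul N] (φ : M →ₙ* N) (x y : M) (z : ℕ → M) (n : ℕ) :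
    malcevPair (φ x) (φ y) (fun k => φ (z k)) n =
      (φ (malcevPair x y z n).1, φ (malcevPair x y z n).2) := by
  induction n with
  | zero => rfl
  | succ n ih => simp [malcevPair, ih]

theorem engelParam_map {M N : Type*} [Monoid M] [Monoid N] (φ : M →* N) (c : M) :
    engelParam (φ c) = fun k => φ (engelParam c k) := by
  funext k
  rcases k with _ | _ | k <;> simp [engelParam]

theorem malcevPair_engelParam_map {M N : Type*} [Monoid M] [Monoid N] (φ : M →* N) (x y c : M)
    (n : ℕ) :
    malcevPair (φ x) (φ y) (engelParam (φ c)) n =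
      (φ (malcevPair x y (engelParam c) n).1, φ (malcevPair x y (engelParam c) n).2) := by
  rw [engelParam_map]
  exact malcevPair_map (φ : M →ₙ* N) x y _ n

/-- The identity `λ_n(a, b, 1, 1, c, …) = ρ_n(a, b, 1, 1, c, …)` for a fixed `n`. -/
def SatisfiesEngel (n : ℕ) (S : Type*) [Semigroup S] : Prop :=
  ∀ (a b : S) (c : WithOne S),
    (malcevPair (a : WithOne S) (b : WithOne S) (engelParam c) n).1 =
      (malcevPair (a : WithOne S) (b : WithOne S) (engelParam c) n).2

theorem isPositivelyEngel_iff {S : Type*} [Semigroup S] :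
    IsPositivelyEngel S ↔ ∃ n, 2 ≤ n ∧ SatisfiesEngel n S := Iff.rfl

theorem SatisfiesEngel.of_injective {n : ℕ} {S T : Type*} [Semigroup S] [Semigroup T]
    (h : SatisfiesEngel n S) (f : T →ₙ* S) (hf : Function.Injective f) : SatisfiesEngel n T := by
  intro a b c
  have h1 := h (f a) (f b) (WithOne.mapMulHom f c)
  have h2 := malcevPair_engelParam_map (WithOne.mapMulHom f) (a : WithOne T) b c n
  simp only [WithOne.mapMulHom_coe] at h2
  rw [h2] at h1
  exact WithOne.mapMulHom_injective hf h1

theorem SatisfiesEngel.of_surjective {n : ℕ} {S T : Type*} [Semigroup S] [Semigroup T]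
    (h : SatisfiesEngel n S) (f : S →ₙ* T) (hf : Function.Surjective f) : SatisfiesEngel n T := by
  intro a b c
  obtain ⟨a, rfl⟩ := hf a
  obtain ⟨b, rfl⟩ := hf b
  obtain ⟨c, rfl⟩ : ∃ c', WithOne.mapMulHom f c' = c := by
    rcases eq_or_ne c 1 with rfl | hc
    · exact ⟨1, map_one _⟩
    · obtain ⟨c, rfl⟩ := WithOne.ne_one_iff_exists.mp hc
      obtain ⟨c, rfl⟩ := hf c
      exact ⟨c, WithOne.mapMulHom_coe f c⟩
  have h2 := malcevPair_engelParam_map (WithOne.mapMulHom f) (a : WithOne S) b c n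
  simp only [WithOne.mapMulHom_coe] at h2
  rw [h2, h a b c]

theorem SatisfiesEngel.of_divides {n : ℕ} {S T : Type*} [Semigroup S] [Semigroup T]
    (h : SatisfiesEngel n S) (hd : SemigroupDivides T S) : SatisfiesEngel n T := by
  obtain ⟨U, f, hf⟩ := hd
  exact (h.of_injective (MulMemClass.subtype U) Subtype.coe_injective).of_surjective f hf

theorem SatisfiesEngel.monoid {n : ℕ} {M : Type*} [Monoid M] (h : SatisfiesEngel n M)
    (a b c : M) :
    (malcevPair a b (engelParam c) n).1 = (malcevPair a b (engelParam c) n).2 := by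
  have h2 := malcevPair_engelParam_map (WithOne.lift (MulHom.id M)) (a : WithOne M) b c n
  simp only [WithOne.lift_coe, MulHom.id_apply] at h2
  rw [h2, h a b c]

theorem malcevPair_fst_eq_snd_of_le {M : Type*} [Mul M] {x y : M} {z : ℕ → M} {m n : ℕ}
    (hmn : m ≤ n) (h : (malcevPair x y z m).1 = (malcevPair x y z m).2) :
    (malcevPair x y z n).1 = (malcevPair x y z n).2 := by
  induction n, hmn using Nat.le_induction with
  | base => exact h
  | succ n _ ih => simp [malcevPair, ih]

/-! ### Block groups and the semigroup `F_7` -/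

theorem SatisfiesEngel.eq_of_left_zero {n : ℕ} {S : Type*} [Semigroup S] (h : SatisfiesEngel n S)
    {e f : S} (hef : e * f = e) (hfe : f * e = f) : e = f := by
  have key : ∀ k, malcevPair (e : WithOne S) f (engelParam 1) k = ((e : WithOne S), (f : WithOne S))
      := by
    intro k
    induction k with
    | zero => rfl
    | succ k ih =>
      have : engelParam (1 : WithOne S) (k + 1) = 1 := by cases k <;> simp [engelParam]
      simp [malcevPair, ih, this, ← WithOne.coe_mul, hef, hfe]
  have := h e f 1
  rw [key] at this
  exact WithOne.coe_injective this

theorem SatisfiesEngel.eq_of_right_zero {n : ℕ} {S : Type*} [Semigroup S] (h : SatisfiesEngel n S)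
    {e f : S} (hef : e * f = f) (hfe : f * e = e) : e = f := by
  by_contra hne
  have key : ∀ k, (malcevPair (e : WithOne S) f (engelParam 1) k = ((e : WithOne S), (f : WithOne S))
      ∨ malcevPair (e : WithOne S) f (engelParam 1) k = ((f : WithOne S), (e : WithOne S))) := by
    intro k
    induction k with
    | zero => exact Or.inl rfl
    | succ k ih =>
      have : engelParam (1 : WithOne S) (k + 1) = 1 := by cases k <;> simp [engelParam]
      rcases ih with ih | ih <;>
        simp [malcevPair, ih, this, ← WithOne.coe_mul, hef, hfe]
  have := h e f 1
  rcases key n with h' | h' <;> rw [h'] at this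
  · exact hne (WithOne.coe_injective this)
  · exact hne (WithOne.coe_injective this).symm

/-- Two inverses `b`, `c` of `a` give a left zero pair `ba`, `ca` and a right zero pair `ab`, `ac`;
once these collapse, `b = bab = cab = cac = c`. -/
theorem SatisfiesEngel.isBlockGroup {n : ℕ} {S : Type*} [Semigroup S] (h : SatisfiesEngel n S) :
    IsBlockGroup S := by
  rintro a b c ⟨hb, hb'⟩ ⟨hc, hc'⟩
  have h1 : b * a = c * a := h.eq_of_left_zero
    (by rw [← mul_assoc, mul_assoc b, mul_assoc b, hc])
    (by rw [← mul_assoc, mul_assoc c, mul_assoc c, hb])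
  have h2 : a * b = a * c := h.eq_of_right_zero
    (by rw [← mul_assoc, hb]) (by rw [← mul_assoc, hc])
  rw [← hb', h1, mul_assoc, h2, ← mul_assoc, hc']

namespace F7

theorem grp_mul_grp (g h : Equiv.Perm (Fin 2)) : grp g * grp h = grp (g.trans h) := rfl
theorem grp_mul_rees (g : Equiv.Perm (Fin 2)) (i j : Fin 2) :
    grp g * rees i j = rees (g.symm i) j := rfl
theorem rees_mul_grp (g : Equiv.Perm (Fin 2)) (i j : Fin 2) :
    rees i j * grp g = rees i (g j) := rfl
theorem rees_mul_rees (i j k l : Fin 2) :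
    rees i j * rees k l = if j = k then rees i l else theta := rfl

theorem not_satisfiesEngel (n : ℕ) : ¬ SatisfiesEngel n F7 := by
  intro h
  set u : F7 := grp (Equiv.swap 0 1) with hu
  have uu : u * u = grp 1 := by simp [hu, grp_mul_grp]; rfl
  -- The power `u ^ (k + 1)` is the next parameter. It always carries the column of one word to the
  -- row of the other, so no product is `theta` and the two words keep different rows.
  have key : ∀ k, ∃ i j : Fin 2, malcevPair (u : WithOne F7) (rees 0 0 : F7) (engelParam (u : WithOne F7))
      (k + 2) = (((rees i j : F7) : WithOne F7), ((rees (1 - i) (1 - j) : F7) : WithOne F7)) ∧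
      (u : WithOne F7) ^ (k + 1) = (if i = j then u else (grp 1 : F7) : F7) := by
    intro k
    induction k with
    | zero =>
      refine ⟨1, 1, ?_, by simp⟩
      simp only [malcevPair, engelParam, mul_one, pow_zero, ← WithOne.coe_mul]
      rfl
    | succ k ih =>
      obtain ⟨i, j, h1, h2⟩ := ih
      rw [pow_succ, malcevPair, h1, engelParam, h2]
      simp only [← WithOne.coe_mul]
      refine ⟨i, 1 - j, ?_, ?_⟩
      · fin_cases i <;> fin_cases j <;> rfl
      · fin_cases i <;> fin_cases j <;> first | rfl | exact congrArg _ uu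
  have h0 := malcevPair_fst_eq_snd_of_le (Nat.le_add_right n 2) (h u (rees 0 0) u)
  obtain ⟨i, j, h1, -⟩ := key n
  rw [h1] at h0
  have := WithOne.coe_injective h0
  revert this
  fin_cases i <;> simp

end F7

/-! ### Finite groups all of whose proper subgroups are nilpotent -/

theorem isNilpotent_of_zpowers_eq_top {G : Type*} [Group G] {g : G}
    (h : Subgroup.zpowers g = ⊤) : Group.IsNilpotent G := by
  have : IsCyclic G := ⟨g, fun x => Subgroup.mem_zpowers_iff.mp (h ▸ Subgroup.mem_top x)⟩
  exact @CommGroup.isNilpotent G IsCyclic.commGroup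

section MinimalNonNilpotent

variable {G : Type*} [Group G] [Finite G]

/-- In a simple group with nilpotent proper subgroups, distinct maximal subgroups meet trivially. -/
theorem inf_eq_bot_of_isCoatom (hp : ∀ H : Subgroup G, H ≠ ⊤ → Group.IsNilpotent H)
    (hs : ∀ N : Subgroup G, N.Normal → N = ⊥ ∨ N = ⊤) {M M' : Subgroup G} (hM : IsCoatom M)
    (hM' : IsCoatom M') (hne : M ≠ M') : M ⊓ M' = ⊥ := by
  suffices H : ∀ D : Subgroup G, ∀ M M' : Subgroup G, IsCoatom M → IsCoatom M' → M ≠ M' →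
      M ⊓ M' = D → D = ⊥ from H _ M M' hM hM' hne rfl
  clear hM hM' hne M M'
  intro D
  induction D using WellFoundedGT.induction with
  | _ D ih =>
  intro M M' hM hM' hne hD
  by_contra hbot
  have hDtop : D ≠ ⊤ := by
    rintro rfl
    exact hM.1 (top_le_iff.mp (hD ▸ inf_le_left))
  have hN : Subgroup.normalizer (D : Set G) ≠ ⊤ := by
    rw [Ne, Subgroup.normalizer_eq_top_iff]
    intro h
    exact (hs D h).elim hbot hDtop
  obtain ⟨L, hL, hNL⟩ := (eq_top_or_exists_le_coatom _).resolve_left hN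
  -- The normalizer of `D` in the nilpotent group `M` is larger than `D`, so `M ⊓ L` properly
  -- contains `D`; if `M ≠ L`, the induction on larger intersections makes it trivial.
  have key : ∀ M M' : Subgroup G, IsCoatom M → IsCoatom M' → M ≠ M' → M ⊓ M' = D → M = L := by
    intro M M' hM hM' hne hD
    by_contra hML
    have hDM : D ≤ M := hD ▸ inf_le_left
    have hDneM : ¬ M ≤ D := by
      intro h
      have h1 : M ≤ M' := h.trans (hD ▸ inf_le_right)
      rcases hM.le_iff.mp h1 with h2 | h2
      · exact hM'.1 h2
      · exact hne h2.symm
    have := hp M hM.1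
    have hlt := Group.normalizerCondition_of_isNilpotent (G := M) (D.subgroupOf M)
      (lt_top_iff_ne_top.mpr (by rwa [Ne, Subgroup.subgroupOf_eq_top]))
    obtain ⟨x, hx, hxD⟩ := SetLike.exists_of_lt hlt
    rw [← Subgroup.subgroupOf_normalizer_eq hDM] at hx
    have hxL : (x : G) ∈ L := hNL hx
    have hDL : D < M ⊓ L := by
      refine lt_of_le_of_ne (le_inf hDM (Subgroup.le_normalizer.trans hNL)) ?_
      intro h
      apply hxD
      rw [Subgroup.mem_subgroupOf, h]
      exact ⟨x.2, hxL⟩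
    have := ih _ hDL M L hM hL hML rfl
    rw [this] at hDL
    exact not_lt_bot hDL
  exact hne ((key M M' hM hM' hne hD).trans
    (key M' M hM' hM hne.symm (by rw [inf_comm, hD])).symm)

theorem eq_map_conj_of_conj_mem (hp : ∀ H : Subgroup G, H ≠ ⊤ → Group.IsNilpotent H)
    (hs : ∀ N : Subgroup G, N.Normal → N = ⊥ ∨ N = ⊤) {M L : Subgroup G} (hM : IsCoatom M)
    (hL : IsCoatom L) {g x : G} (hx : x ≠ 1) (hxM : x ∈ M) (hgx : g * x * g⁻¹ ∈ L) :
    L = M.map (MulAut.conj g).toMonoidHom := by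
  by_contra hne
  have hM' : IsCoatom (M.map (MulAut.conj g).toMonoidHom) :=
    ((MulAut.conj g).mapSubgroup.isCoatom_iff M).mpr hM
  have h := inf_eq_bot_of_isCoatom hp hs hL hM' hne
  have h1 : g * x * g⁻¹ ∈ L ⊓ M.map (MulAut.conj g).toMonoidHom :=
    ⟨hgx, ⟨x, hxM, by simp⟩⟩
  rw [h, Subgroup.mem_bot] at h1
  exact hx (by simpa using h1)

omit [Finite G] in
theorem mem_of_map_conj_eq (hs : ∀ N : Subgroup G, N.Normal → N = ⊥ ∨ N = ⊤) {M : Subgroup G}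
    (hM : IsCoatom M) (hMb : M ≠ ⊥) {g : G} (h : M = M.map (MulAut.conj g).toMonoidHom) :
    g ∈ M := by
  have hN : Subgroup.normalizer (M : Set G) ≠ ⊤ := by
    rw [Ne, Subgroup.normalizer_eq_top_iff]
    intro h
    exact (hs M h).elim hMb hM.1
  have h1 := (hM.le_iff.mp (Subgroup.le_normalizer (H := M))).resolve_left hN
  rw [← h1, Subgroup.mem_normalizer_iff_map_conj_eq]
  exact h.symm

/-- The conjugate of `x` by the representative of a coset. -/
noncomputable def conjOut (M : Subgroup G) (q : (G ⧸ M) × {x : M // x ≠ 1}) : G :=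
  q.1.out * q.2.1 * q.1.out⁻¹

theorem conjOut_injective (hp : ∀ H : Subgroup G, H ≠ ⊤ → Group.IsNilpotent H)
    (hs : ∀ N : Subgroup G, N.Normal → N = ⊥ ∨ N = ⊤) {M : Subgroup G} (hM : IsCoatom M)
    (hMb : M ≠ ⊥) : Function.Injective (conjOut M) := by
  rintro ⟨q, ⟨x, hxM⟩, hx⟩ ⟨r, ⟨y, hyM⟩, hy⟩ h
  simp only [conjOut] at h
  have hx' : x ≠ 1 := fun h => hx (Subtype.ext h)
  have h1 : (r.out⁻¹ * q.out) * x * (r.out⁻¹ * q.out)⁻¹ = y := by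
    rw [mul_inv_rev, inv_inv, show r.out⁻¹ * q.out * x * (q.out⁻¹ * r.out) =
      r.out⁻¹ * (q.out * x * q.out⁻¹) * r.out by group, h]
    group
  have h2 := mem_of_map_conj_eq hs hM hMb
    (eq_map_conj_of_conj_mem hp hs hM hM hx' hxM (by rw [h1]; exact hyM))
  have h3 : q = r := by
    rw [← QuotientGroup.out_eq' q, ← QuotientGroup.out_eq' r]
    exact (QuotientGroup.eq.mpr h2).symm
  subst h3
  simp only [inv_mul_cancel, one_mul, inv_one, mul_one] at h1
  subst h1
  rfl

theorem card_conjOut_domain (M : Subgroup G) :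
    Nat.card ((G ⧸ M) × {x : M // x ≠ 1}) + M.index = Nat.card G := by
  rw [Nat.card_prod, ← M.index_eq_card]
  have h1 : Nat.card {x : M // x ≠ 1} + 1 = Nat.card M := by
    classical
    have := Fintype.ofFinite M
    rw [Nat.card_eq_fintype_card, Nat.card_eq_fintype_card, Fintype.card_subtype_compl,
      Fintype.card_subtype_eq]
    have := Fintype.card_pos (α := M)
    omega
  rw [← M.index_mul_card, ← h1]
  ring

/-- In a simple counterexample the maximal subgroups meet trivially and are self-normalizing, so the
conjugates of `M` contain exactly `|G| - |G : M|` nonidentity elements. As the index is at least 2,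
some `y ≠ 1` is missed. A maximal `L` containing `y` is not conjugate to `M`, and the two classes
together have at least `|G|` nonidentity elements, which is too many. -/
theorem exists_normal_of_not_isNilpotent
    (hp : ∀ H : Subgroup G, H ≠ ⊤ → Group.IsNilpotent H) (hG : ¬ Group.IsNilpotent G) :
    ∃ N : Subgroup G, N.Normal ∧ N ≠ ⊥ ∧ N ≠ ⊤ := by
  by_contra! hs'
  have hs : ∀ N : Subgroup G, N.Normal → N = ⊥ ∨ N = ⊤ := fun N hN => by
    by_cases h : N = ⊥
    · exact Or.inl h
    · exact Or.inr (hs' N hN h)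
  have hz : ∀ g : G, Subgroup.zpowers g ≠ ⊤ := fun g h => hG (isNilpotent_of_zpowers_eq_top h)
  have hcov : ∀ g : G, ∃ M : Subgroup G, IsCoatom M ∧ g ∈ M := fun g => by
    obtain ⟨M, hM, h⟩ := (eq_top_or_exists_le_coatom _).resolve_left (hz g)
    exact ⟨M, hM, h (Subgroup.mem_zpowers g)⟩
  have hnt : Nontrivial G := by
    by_contra h
    rw [not_nontrivial_iff_subsingleton] at h
    exact hG inferInstance
  have hbot : ∀ M : Subgroup G, IsCoatom M → M ≠ ⊥ := by
    rintro M hM rfl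
    obtain ⟨g, hg⟩ := exists_ne (1 : G)
    exact hz g (hM.2 _ (bot_lt_iff_ne_bot.mpr (by simpa using hg)))
  have hcard : ∀ M : Subgroup G, IsCoatom M →
      2 ≤ M.index ∧ 2 * M.index ≤ Nat.card G := by
    intro M hM
    constructor
    · have h0 : M.index ≠ 0 := Subgroup.index_ne_zero_of_finite
      have h1 : M.index ≠ 1 := by rw [Ne, Subgroup.index_eq_one]; exact hM.1
      omega
    · rw [← M.index_mul_card, mul_comm]
      apply Nat.mul_le_mul_left
      exact Subgroup.one_lt_card_iff_ne_bot M |>.mpr (hbot M hM)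
  obtain ⟨M, hM, -⟩ := hcov 1
  obtain ⟨y, hy1, hy⟩ : ∃ y : G, y ≠ 1 ∧ y ∉ Set.range (conjOut M) := by
    by_contra! h
    have hsurj : Function.Surjective (fun o : Option ((G ⧸ M) × {x : M // x ≠ 1}) =>
        o.elim 1 (conjOut M)) := by
      intro y
      by_cases hy : y = 1
      · exact ⟨none, hy.symm⟩
      · obtain ⟨q, hq⟩ := h y hy
        exact ⟨some q, hq⟩
    have h1 := Nat.card_le_card_of_surjective _ hsurj
    rw [Finite.card_option] at h1
    have h2 := card_conjOut_domain M
    have h3 := (hcard M hM).1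
    omega
  obtain ⟨L, hL, hyL⟩ := hcov y
  have hinj : Function.Injective (fun o : Option (((G ⧸ M) × {x : M // x ≠ 1}) ⊕
      ((G ⧸ L) × {x : L // x ≠ 1})) => o.elim 1 (Sum.elim (conjOut M) (conjOut L))) := by
    have h1 : ∀ (K : Subgroup G) q, conjOut K q ≠ 1 := by
      rintro K ⟨q, x, hx⟩ h
      exact hx (by simpa [conjOut] using h)
    have h2 : ∀ q r, conjOut M q ≠ conjOut L r := by
      rintro ⟨q, ⟨x, hxM⟩, hx⟩ ⟨r, ⟨z, hzL⟩, hz⟩ h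
      simp only [conjOut] at h
      have hx' : x ≠ 1 := fun h => hx (Subtype.ext h)
      have h3 : (r.out⁻¹ * q.out) * x * (r.out⁻¹ * q.out)⁻¹ = z := by
        rw [mul_inv_rev, inv_inv, show r.out⁻¹ * q.out * x * (q.out⁻¹ * r.out) =
          r.out⁻¹ * (q.out * x * q.out⁻¹) * r.out by group, h]
        group
      have h4 := eq_map_conj_of_conj_mem hp hs hM hL hx' hxM (by rw [h3]; exact hzL)
      rw [h4] at hyL
      obtain ⟨w, hw, rfl⟩ := hyL
      set g := r.out⁻¹ * q.out
      -- The chosen representative of the coset of `g` is `g * n` with `n` in `M`, so the element of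
      -- `M` is conjugated by `n⁻¹` to compensate.
      obtain ⟨n, hn⟩ := QuotientGroup.mk_out_eq_mul M g
      apply hy
      refine ⟨((g : G ⧸ M), ⟨n⁻¹ * ⟨w, hw⟩ * n, ?_⟩), ?_⟩
      · intro h5
        apply hy1
        have h6 := congrArg Subtype.val h5
        simp only [Subgroup.coe_mul, Subgroup.coe_inv, Subgroup.coe_one] at h6
        have h7 : w = 1 := by
          have := congrArg (fun a => (n : G) * a * (n : G)⁻¹) h6
          simpa [mul_assoc] using this
        simp [h7]
      · simp [conjOut, hn, mul_assoc]
    rintro (_ | q | q) (_ | r | r) h <;> simp only [Option.elim, Sum.elim_inl, Sum.elim_inr] at h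
    · rfl
    · exact absurd h.symm (h1 _ _)
    · exact absurd h.symm (h1 _ _)
    · exact absurd h (h1 _ _)
    · rw [conjOut_injective hp hs hM (hbot M hM) h]
    · exact absurd h (h2 _ _)
    · exact absurd h (h1 _ _)
    · exact absurd h.symm (h2 _ _)
    · rw [conjOut_injective hp hs hL (hbot L hL) h]
  have h1 := Nat.card_le_card_of_injective _ hinj
  rw [Finite.card_option, Nat.card_sum] at h1
  have h2 := card_conjOut_domain M
  have h3 := card_conjOut_domain L
  have h4 := (hcard M hM).2
  have h5 := (hcard L hL).2
  omega

end MinimalNonNilpotent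

/-! ### Unipotent actions on elementary abelian groups -/

/-- In characteristic `p`, `1 - t ^ p ^ n = (1 - t) ^ p ^ n`, which vanishes since `p ^ n ≥ n`. -/
theorem exists_pow_prime_pow_eq_one_of_sub_pow_eq_zero {R : Type*} [Ring R] {p : ℕ}
    [Fact p.Prime] (hp : (p : R) = 0) {t : R} {n : ℕ} (h : (1 - t) ^ n = 0) :
    ∃ k : ℕ, t ^ p ^ k = 1 := by
  rcases subsingleton_or_nontrivial R with hR | hR
  · exact ⟨0, Subsingleton.elim _ _⟩
  have : CharP R p := (CharP.charP_iff_prime_eq_zero Fact.out).mpr hp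
  refine ⟨n, ?_⟩
  have h1 := sub_pow_char_pow_of_commute (p := p) (n := n) (Commute.one_left t)
  rw [pow_eq_zero_of_le (Nat.lt_pow_self (Fact.out : p.Prime).one_lt).le h, one_pow] at h1
  exact (sub_eq_zero.mp h1.symm).symm

theorem exists_mulAut_pow_prime_pow_eq_one {A : Type*} [CommGroup A] {p : ℕ} [Fact p.Prime]
    (hp : ∀ a : A, a ^ p = 1) (φ : MulAut A) {n : ℕ}
    (h : ∀ a : A, (fun x => x * (φ x)⁻¹)^[n] a = 1) : ∃ k : ℕ, φ ^ p ^ k = 1 := by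
  set t : AddMonoid.End (Additive A) := MonoidHom.toAdditive φ.toMonoidHom with ht
  have ht1 : ∀ a : A, t (Additive.ofMul a) = Additive.ofMul (φ a) := fun a => rfl
  have ht2 : ∀ k : ℕ, ∀ a : A, (t ^ k) (Additive.ofMul a) = Additive.ofMul ((φ ^ k) a) := by
    intro k
    induction k with
    | zero => intro a; rfl
    | succ k ih => intro a; rw [pow_succ', pow_succ', AddMonoid.End.coe_mul, Function.comp_apply, ih, ht1]; rfl
  have ht3 : ∀ k : ℕ, ∀ a : A, ((1 - t) ^ k) (Additive.ofMul a) =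
      Additive.ofMul ((fun x => x * (φ x)⁻¹)^[k] a) := by
    intro k
    induction k with
    | zero => intro a; rfl
    | succ k ih =>
      intro a
      rw [pow_succ', AddMonoid.End.coe_mul, Function.comp_apply, ih, Function.iterate_succ_apply']
      simp only [ofMul_mul, ofMul_inv,
        sub_eq_add_neg]
      rfl
  have hp' : (p : AddMonoid.End (Additive A)) = 0 := by
    ext a
    rw [AddMonoid.End.natCast_apply]
    exact hp a
  obtain ⟨k, hk⟩ := exists_pow_prime_pow_eq_one_of_sub_pow_eq_zero hp' (t := t) (n := n) (by
    ext a
    exact (ht3 n a).trans (h a))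
  refine ⟨k, MulEquiv.ext fun a => ?_⟩
  have := ht2 (p ^ k) a
  rw [hk] at this
  exact this.symm

/-- With `b = c⁻¹` the parameter `c ^ n` cancels all but one factor of `c⁻¹ ^ (n + 1)`. Hence both
words stay in one coset of `H`, and the quotient of their `H`-parts evolves by `1 - t`, where `t` is
conjugation by `c⁻¹`. -/
theorem malcevPair_engelParam_inv {G : Type*} [Group G] (H : Subgroup G) [H.Normal]
    (hH : ∀ x ∈ H, ∀ y ∈ H, x * y = y * x) {a : G} (ha : a ∈ H) (c : G) (n : ℕ) :
    ∃ x ∈ H, ∃ y ∈ H,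
      malcevPair a c⁻¹ (engelParam c) (n + 1) = (x * c⁻¹ ^ (n + 1), y * c⁻¹ ^ (n + 1)) ∧
      x * y⁻¹ = (fun x => x * (c⁻¹ * x * c)⁻¹)^[n + 1] a := by
  have hc : ∀ x ∈ H, c⁻¹ * x * c ∈ H := fun x hx => by
    simpa using ‹H.Normal›.conj_mem x hx c⁻¹
  induction n with
  | zero => exact ⟨a, ha, c⁻¹ * a * c, hc a ha, by simp [malcevPair, engelParam], by simp⟩
  | succ n ih =>
    obtain ⟨x, hx, y, hy, h1, h2⟩ := ih
    refine ⟨x * (c⁻¹ * y * c), H.mul_mem hx (hc y hy), y * (c⁻¹ * x * c),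
      H.mul_mem hy (hc x hx), ?_, ?_⟩
    · have h3 : c⁻¹ ^ (n + 1) * c ^ n = c⁻¹ := by rw [pow_succ']; simp
      have h4 : ∀ x y : G, x * c⁻¹ ^ (n + 1) * c ^ n * (y * c⁻¹ ^ (n + 1)) =
          x * (c⁻¹ * y * c) * c⁻¹ ^ (n + 1 + 1) := by
        intro x y
        rw [mul_assoc x, h3, pow_succ' _ (n + 1)]
        group
      rw [malcevPair, h1, engelParam, h4, h4]
    · rw [Function.iterate_succ_apply', ← h2]
      have h3 := hH _ (H.inv_mem hy) _ (hc _ (H.mul_mem hy (H.inv_mem hx)))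
      calc x * (c⁻¹ * y * c) * (y * (c⁻¹ * x * c))⁻¹
          = x * (c⁻¹ * (y * x⁻¹) * c * y⁻¹) := by group
        _ = x * y⁻¹ * (c⁻¹ * (x * y⁻¹) * c)⁻¹ := by rw [← h3]; group

theorem exists_mem_center_of_engel {G : Type*} [Group G] [Finite G] {n : ℕ}
    (h : SatisfiesEngel n G) {p : ℕ} [Fact p.Prime] (H : Subgroup G) [H.Normal]
    (hH : ∀ x ∈ H, ∀ y ∈ H, x * y = y * x) (hp : ∀ x ∈ H, x ^ p = 1) (hb : H ≠ ⊥) :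
    Subgroup.center G ≠ ⊥ := by
  let : CommGroup H :=
    { (inferInstance : Group H) with
      mul_comm := fun x y => Subtype.ext (hH x x.2 y y.2) }
  have hpow : ∀ g : G, ∃ k : ℕ, (MulAut.conjNormal g : MulAut H) ^ p ^ k = 1 := by
    intro g
    refine exists_mulAut_pow_prime_pow_eq_one (fun a => Subtype.ext (hp a a.2)) _ (n := n + 1) ?_
    intro a
    obtain ⟨x, -, y, -, h1, h2⟩ := malcevPair_engelParam_inv H hH a.2 g⁻¹ n
    have h3 := malcevPair_fst_eq_snd_of_le (Nat.le_succ n) (h.monoid (a : G) g⁻¹⁻¹ g⁻¹)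
    rw [h1] at h3
    have h4 : x = y := mul_right_cancel h3
    rw [h4, mul_inv_cancel] at h2
    have h5 : ∀ k : ℕ, (((fun x : H => x * (MulAut.conjNormal g x)⁻¹)^[k] a : H) : G) =
        (fun x : G => x * (g⁻¹⁻¹ * x * g⁻¹)⁻¹)^[k] (a : G) := by
      intro k
      induction k with
      | zero => rfl
      | succ k ih =>
        rw [Function.iterate_succ_apply', Function.iterate_succ_apply', ← ih]
        simp
    exact Subtype.ext ((h5 _).trans h2.symm)
  have hP : IsPGroup p (MulAut.conjNormal (H := H)).range := by
    rw [isPGroup_iff_pow_pow_eq_one]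
    rintro ⟨_, g, rfl⟩
    obtain ⟨k, hk⟩ := hpow g
    exact ⟨k, Subtype.ext hk⟩
  have hdvd : p ∣ Nat.card H := by
    obtain ⟨⟨x, hx⟩, hx1⟩ := Subgroup.ne_bot_iff_exists_ne_one.mp hb
    have := orderOf_eq_prime (p := p) (x := (⟨x, hx⟩ : H)) (Subtype.ext (hp x hx)) hx1
    rw [← this]
    exact orderOf_dvd_natCard _
  obtain ⟨b, hbf, hb1⟩ := hP.exists_fixed_point_of_prime_dvd_card_of_fixed_point H hdvd
    (a := 1) (fun g => map_one g.1)
  rw [Ne, Subgroup.eq_bot_iff_forall]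
  intro hc
  apply hb1
  refine Subtype.ext (hc b ?_).symm
  rw [Subgroup.mem_center_iff]
  intro g
  have := congrArg Subtype.val (hbf ⟨_, g, rfl⟩)
  have h6 : g * (b : G) * g⁻¹ = b := this
  exact mul_inv_eq_iff_eq_mul.mp h6

/-! ### Finite positively Engel groups are nilpotent, and nilpotent groups are positively Engel -/

theorem center_ne_bot_of_engel {G : Type*} [Group G] [Finite G] {n : ℕ}
    (h : SatisfiesEngel n G) (A : Subgroup G) [A.Normal]
    (hA : ∀ x ∈ A, ∀ y ∈ A, x * y = y * x) (hb : A ≠ ⊥) : Subgroup.center G ≠ ⊥ := by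
  have h1 : Nat.card A ≠ 1 := by rwa [Ne, Subgroup.card_eq_one]
  obtain ⟨p, hp, hpA⟩ := Nat.exists_prime_and_dvd h1
  have : Fact p.Prime := ⟨hp⟩
  obtain ⟨⟨x, hx⟩, hxp⟩ := exists_prime_orderOf_dvd_card' p hpA
  let H : Subgroup G :=
    { carrier := {x | x ∈ A ∧ x ^ p = 1}
      one_mem' := ⟨A.one_mem, one_pow p⟩
      mul_mem' := fun {x y} hx hy => ⟨A.mul_mem hx.1 hy.1, by
        rw [Commute.mul_pow (hA x hx.1 y hy.1), hx.2, hy.2, one_mul]⟩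
      inv_mem' := fun {x} hx => ⟨A.inv_mem hx.1, by rw [inv_pow, hx.2, inv_one]⟩ }
  have hN : H.Normal := ⟨fun x hx g => ⟨‹A.Normal›.conj_mem x hx.1 g, by
    rw [conj_pow, hx.2, mul_one, mul_inv_cancel]⟩⟩
  refine exists_mem_center_of_engel h (p := p) H (fun x hx y hy => hA x hx.1 y hy.1)
    (fun x hx => hx.2) ?_
  intro hH
  have h2 : x ∈ H := ⟨hx, by
    have := pow_orderOf_eq_one (⟨x, hx⟩ : A)
    rw [hxp] at this
    exact congrArg Subtype.val this⟩
  rw [hH, Subgroup.mem_bot] at h2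
  subst h2
  have h3 : orderOf (1 : A) = p := hxp
  rw [orderOf_one] at h3
  exact hp.one_lt.ne h3

theorem SatisfiesEngel.isNilpotent {n : ℕ} {G : Type*} [Group G] [Finite G]
    (h : SatisfiesEngel n G) : Group.IsNilpotent G := by
  obtain ⟨k, hk⟩ : ∃ k, Nat.card G = k := ⟨_, rfl⟩
  induction k using Nat.strong_induction_on generalizing G with
  | _ k ih =>
  subst hk
  have hp : ∀ H : Subgroup G, H ≠ ⊤ → Group.IsNilpotent H := fun H hH =>
    ih _ (lt_of_le_of_ne (Subgroup.card_le_card_group H)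
      (fun h => hH (Subgroup.eq_top_of_card_eq H h)))
      (h.of_injective (H.subtype : H →ₙ* G) Subtype.coe_injective) rfl
  by_contra hG
  obtain ⟨N, hN, hNb, hNt⟩ := exists_normal_of_not_isNilpotent hp hG
  have := hp N hNt
  have hNn : Nontrivial N := (Subgroup.nontrivial_iff_ne_bot N).mpr hNb
  have hc := Group.IsNilpotent.center_ne_bot (G := N)
  let A : Subgroup G := (Subgroup.center N).map N.subtype
  have hA : A ≠ ⊥ := by
    rwa [Ne, Subgroup.map_eq_bot_iff_of_injective _ Subtype.coe_injective]
  have hZ := center_ne_bot_of_engel h A (by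
    rintro _ ⟨x, hx, rfl⟩ _ ⟨y, hy, rfl⟩
    exact congrArg Subtype.val ((Subgroup.mem_center_iff.mp hx y).symm)) hA
  apply hG
  refine Group.of_quotient_center_nilpotent (ih _ ?_ (h.of_surjective
    (QuotientGroup.mk' (Subgroup.center G) : G →ₙ* _) (QuotientGroup.mk'_surjective _)) rfl)
  rw [← Subgroup.index_eq_card, ← (Subgroup.center G).index_mul_card]
  have h1 := (Subgroup.one_lt_card_iff_ne_bot _).mpr hZ
  have h2 : (Subgroup.center G).index ≠ 0 := Subgroup.index_ne_zero_of_finite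
  exact lt_mul_of_one_lt_right (Nat.pos_of_ne_zero h2) h1

/-- The quotient `λ_{n+1} ρ_{n+1}⁻¹` is the commutator of `λ_n ρ_n⁻¹` with `ρ_n z_{n+1}`. -/
theorem malcevPair_div_mem_lowerCentralSeries {G : Type*} [Group G] (a b : G) (z : ℕ → G) (n : ℕ) :
    (malcevPair a b z n).1 * (malcevPair a b z n).2⁻¹ ∈
      (⊤ : Subgroup G).lowerCentralSeries n := by
  induction n with
  | zero => simp
  | succ n ih =>
    rw [Subgroup.mem_lowerCentralSeries_succ_iff]
    refine Subgroup.subset_closure ⟨_, ih, (malcevPair a b z n).2 * z (n + 1), trivial, ?_⟩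
    simp only [malcevPair, commutatorElement_def]
    group

theorem Group.IsNilpotent.exists_malcevPair_eq {G : Type*} [Group G] (h : Group.IsNilpotent G) :
    ∃ n, ∀ (a b : G) (z : ℕ → G), (malcevPair a b z n).1 = (malcevPair a b z n).2 := by
  obtain ⟨n, hn⟩ := Subgroup.nilpotent_iff_lowerCentralSeries.mp h
  refine ⟨n, fun a b z => ?_⟩
  have := malcevPair_div_mem_lowerCentralSeries a b z n
  rw [hn, Subgroup.mem_bot] at this
  exact mul_inv_eq_one.mp this

/-! ### Idempotents of finite block groups -/

section Moves

variable {M : Type*} [Monoid M]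

theorem IsBlockGroup.eq_of_left_zero (hM : IsBlockGroup M) {p q : M} (hpp : p * p = p)
    (hqq : q * q = q) (hpq : p * q = p) (hqp : q * p = q) : p = q :=
  hM p p q ⟨by rw [hpp, hpp], by rw [hpp, hpp]⟩ ⟨by rw [hpq, hpp], by rw [hqp, hqq]⟩

theorem IsBlockGroup.eq_of_right_zero (hM : IsBlockGroup M) {p q : M} (hpp : p * p = p)
    (hpq : p * q = q) (hqp : q * p = p) : p = q :=
  hM p p q ⟨by rw [hpp, hpp], by rw [hpp, hpp]⟩ ⟨by rw [hpq, hqp], by rw [hqp, hpq]⟩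

/-- An idempotent below `e` that generates an ideal containing `e` is equal to `e`. -/
theorem eq_of_idempotent_le [Finite M] {e g a b : M} (he : e * e = e) (hg : g * g = g)
    (heg : e * g = g) (hge : g * e = g) (h : e = a * g * b) : g = e := by
  set α := e * a * g with hα
  set β := g * b * e with hβ
  have hαβ : α * β = e := by
    calc α * β = e * a * (g * g) * b * e := by simp only [hα, hβ, mul_assoc]
      _ = e * (a * g * b) * e := by rw [hg]; simp only [mul_assoc]
      _ = e := by rw [← h, he, he]
  have hαe : α * e = α := by rw [hα, mul_assoc, hge]
  have hαg : α * g = α := by rw [hα, mul_assoc, hg]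
  have hpow : ∀ n : ℕ, α ^ n * e * β ^ n = e := by
    intro n
    induction n with
    | zero => simp
    | succ n ih =>
      rw [pow_succ, pow_succ', mul_assoc (α ^ n), hαe, mul_assoc, ← mul_assoc α, hαβ, ← mul_assoc,
        ih]
  -- A repeated power of `α` makes `e` a product ending in `α`, hence in `g`; so `e * g = e`.
  have key : ∀ m k : ℕ, m < k → α ^ m = α ^ k → g = e := by
    intro m k hmk hpk
    obtain ⟨d, rfl⟩ := Nat.exists_eq_add_of_lt hmk
    have h1 := hpow m
    rw [hpk, show m + d + 1 = (d + 1) + m by ring, pow_add, mul_assoc (α ^ (d + 1)), mul_assoc,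
      hpow m, pow_succ, mul_assoc, hαe] at h1
    rw [← heg, ← h1, mul_assoc, hαg]
  obtain ⟨m, k, hmk, h1⟩ := Finite.exists_ne_map_eq_of_infinite (fun n : ℕ => α ^ n)
  rcases lt_or_gt_of_ne hmk with h2 | h2
  · exact key m k h2 h1
  · exact key k m h2 h1.symm

/-- In the partial action of `s` by right multiplication, the idempotent `p` goes to `q`. -/
def Moves (p s q : M) : Prop :=
  p * s * q = p * s ∧ ∃ x, p * s * x = p

theorem Moves.comp {p q r s t : M} (h : Moves p s q) (h' : Moves q t r) :
    Moves p (s * t) r := by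
  obtain ⟨h1, x, hx⟩ := h
  obtain ⟨h2, y, hy⟩ := h'
  refine ⟨?_, y * x, ?_⟩
  · rw [← mul_assoc, ← h1, mul_assoc (p * s), mul_assoc (p * s), h2]
  · rw [← mul_assoc p, ← h1, mul_assoc (p * s), mul_assoc (p * s), ← mul_assoc (q * t), hy,
      ← mul_assoc, h1, hx]

theorem Moves.pow {p s : M} (h : Moves p s p) (hp : p * p = p) (n : ℕ) : Moves p (s ^ n) p := by
  induction n with
  | zero => exact ⟨by simp [hp], 1, by simp⟩
  | succ n ih => rw [pow_succ]; exact ih.comp h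

variable [Finite M]

/-- Take `β = q x p`, where `p s x = p`. Then `β s` is an idempotent below `q` whose ideal contains
`q`, so finiteness gives `β s = q`. -/
theorem Moves.exists_inverse {p q s : M} (h : Moves p s q) (hp : p * p = p) (hq : q * q = q)
    (hJ : ∃ u v, q = u * p * v) :
    ∃ β, q * β = β ∧ β * p = β ∧ p * s * β = p ∧ β * s = q := by
  obtain ⟨h1, x, hx⟩ := h
  obtain ⟨u, v, huv⟩ := hJ
  have e1 : q * (q * x * p) = q * x * p := by rw [← mul_assoc, ← mul_assoc, hq]
  have e2 : q * x * p * p = q * x * p := by rw [mul_assoc, hp]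
  have e3 : p * s * (q * x * p) = p := by
    rw [← mul_assoc, ← mul_assoc, h1, hx, hp]
  have e4 : p * s * (q * x * p * s) = p * s := by rw [← mul_assoc, e3]
  have e5 : q * x * p * s * q = q * x * p * s := by
    rw [mul_assoc (q * x), mul_assoc (q * x), h1]
  refine ⟨q * x * p, e1, e2, e3, eq_of_idempotent_le (a := u * (p * s)) (b := q * x * p * v) hq ?_ ?_
    e5 ?_⟩
  · calc q * x * p * s * (q * x * p * s) = q * x * (p * s * (q * x * p * s)) := by
          simp only [mul_assoc]
      _ = q * x * p * s := by rw [e4]; simp only [mul_assoc]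
  · rw [← mul_assoc, e1]
  · calc q = u * p * v := huv
      _ = u * (p * s * (q * x * p * s) * (q * x * p)) * v := by rw [e4, e3]
      _ = _ := by simp only [mul_assoc]

/-- The reverse elements `β` obtained from `p` and from `p'` are both inverses of `s q`, so they
coincide; this makes `p`, `p'` a left zero pair. -/
theorem Moves.left_injective (hM : IsBlockGroup M) {p p' q s : M} (h : Moves p s q)
    (h' : Moves p' s q) (hp : p * p = p) (hp' : p' * p' = p') (hq : q * q = q)
    (hJ : ∃ u v, q = u * p * v) (hJ' : ∃ u v, q = u * p' * v) : p = p' := by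
  obtain ⟨β, h1, h2, h3, h4⟩ := h.exists_inverse hp hq hJ
  obtain ⟨γ, k1, k2, k3, k4⟩ := h'.exists_inverse hp' hq hJ'
  have key : ∀ β : M, q * β = β → β * s = q → IsSemigroupInverse (s * q) β := fun β h1 h4 =>
    ⟨by rw [mul_assoc s, h1, mul_assoc, ← mul_assoc β, h4, hq], by rw [← mul_assoc, h4, hq, h1]⟩
  obtain rfl := hM _ _ _ (key β h1 h4) (key γ k1 k4)
  refine hM.eq_of_left_zero hp hp' ?_ ?_
  · conv_lhs => rw [← h3]
    rw [mul_assoc, k2, h3]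
  · conv_lhs => rw [← k3]
    rw [mul_assoc, h2, k3]

theorem Moves.right_unique (hM : IsBlockGroup M) {p q q' s : M} (h : Moves p s q)
    (h' : Moves p s q') (hp : p * p = p) (hq : q * q = q) (hq' : q' * q' = q')
    (hJ : ∃ u v, q = u * p * v) (hJ' : ∃ u v, q' = u * p * v) : q = q' := by
  obtain ⟨β, h1, h2, h3, h4⟩ := h.exists_inverse hp hq hJ
  obtain ⟨γ, k1, k2, k3, k4⟩ := h'.exists_inverse hp hq' hJ'
  refine hM.eq_of_left_zero hq hq' ?_ ?_
  · rw [← h4, ← h2, mul_assoc β, mul_assoc β, h'.1]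
  · rw [← k4, ← k2, mul_assoc γ, mul_assoc γ, h.1]

theorem Moves.exists_mul_eq {p q s t x : M} (h : Moves p s q) (hx : p * (s * t) * x = p)
    (hp : p * p = p) (hq : q * q = q) (hJ : ∃ u v, q = u * p * v) : q * t * (x * s) = q := by
  obtain ⟨β, h1, h2, h3, h4⟩ := h.exists_inverse hp hq hJ
  calc q * t * (x * s) = β * p * s * t * x * s := by rw [h2, h4]; simp only [mul_assoc]
    _ = β * (p * (s * t) * x) * s := by simp only [mul_assoc]
    _ = q := by rw [hx, h2, h4]

theorem Moves.cancel {p q r s t : M} (h : Moves p s q) (h' : Moves p (s * t) r)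
    (hp : p * p = p) (hq : q * q = q) (hJ : ∃ u v, q = u * p * v) : Moves q t r := by
  obtain ⟨k1, x, hx⟩ := h'
  refine ⟨?_, x * s, h.exists_mul_eq hx hp hq hJ⟩
  obtain ⟨β, h1, h2, h3, h4⟩ := h.exists_inverse hp hq hJ
  have e : q * t = β * (p * (s * t)) := by rw [← mul_assoc β, h2, ← mul_assoc, h4]
  rw [e, mul_assoc β, k1]

/-- The reverse `β` for `s q` gives a right zero pair `q`, `β s`. Hence `q = β s`, and `p s q = p s
β s = p s`. -/
theorem Moves.of_mul_eq (hM : IsBlockGroup M) {p q s x : M} (h : p * s * q * x = p)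
    (hp : p * p = p) (hq : q * q = q) (hJ : ∃ u v, q = u * p * v) : Moves p s q := by
  have h0 : Moves p (s * q) q := ⟨by rw [mul_assoc, mul_assoc, hq], x, by rw [← mul_assoc, h]⟩
  obtain ⟨β, h1, h2, h3, h4⟩ := h0.exists_inverse hp hq hJ
  have h5 : p * s * β = p := by rw [← h1, ← mul_assoc, mul_assoc p s q, h3]
  have hh : q = β * s := by
    refine hM.eq_of_right_zero hq ?_ ?_
    · rw [← mul_assoc, h1]
    · rw [mul_assoc, h4]
  refine ⟨?_, q * x, by rw [← mul_assoc, h]⟩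
  rw [hh, ← mul_assoc, h5]

end Moves

/-! ### A criterion for `F_7` to divide a semigroup -/

namespace F7

/-- The partial injection of the indices given by an element of `F_7`, as a relation. -/
def Act : F7 → Fin 2 → Fin 2 → Prop
  | theta, _, _ => False
  | rees i j, a, b => a = i ∧ b = j
  | grp g, a, b => g a = b

theorem act_mul (x y : F7) (a b : Fin 2) :
    Act (x * y) a b ↔ ∃ c, Act x a c ∧ Act y c b := by
  rcases x with _ | ⟨i, j⟩ | g <;> rcases y with _ | ⟨k, l⟩ | h
  · simp [Act, show theta * theta = theta from rfl]
  · simp [Act, show theta * rees k l = theta from rfl]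
  · simp [Act, show theta * grp h = theta from rfl]
  · simp [Act, show rees i j * theta = theta from rfl]
  · rw [rees_mul_rees]
    split_ifs with hjk
    · subst hjk
      exact ⟨fun h => ⟨j, ⟨h.1, rfl⟩, rfl, h.2⟩, fun ⟨_, h1, h2⟩ => ⟨h1.1, h2.2⟩⟩
    · simp only [Act, false_iff, not_exists]
      rintro c ⟨⟨-, rfl⟩, rfl, -⟩
      exact hjk rfl
  · rw [rees_mul_grp]
    exact ⟨fun h => ⟨j, ⟨h.1, rfl⟩, h.2.symm⟩, fun ⟨_, h1, h2⟩ => ⟨h1.1, by rw [← h2, h1.2]⟩⟩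
  · simp [Act, show grp g * theta = theta from rfl]
  · rw [grp_mul_rees]; simp [Act, Equiv.eq_symm_apply]
  · rw [grp_mul_grp]; simp [Act]

theorem act_injective {x y : F7} (h : ∀ a b, Act x a b ↔ Act y a b) : x = y := by
  rcases x with _ | ⟨i, j⟩ | g <;> rcases y with _ | ⟨k, l⟩ | g'
  · rfl
  · exact absurd ((h k l).mpr ⟨rfl, rfl⟩) id
  · exact absurd ((h 0 (g' 0)).mpr rfl) id
  · exact absurd ((h i j).mp ⟨rfl, rfl⟩) id
  · obtain ⟨rfl, rfl⟩ := (h i j).mp ⟨rfl, rfl⟩; rfl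
  · have := ((h (1 - i) (g' (1 - i))).mpr rfl).1
    revert this; fin_cases i <;> simp
  · exact absurd ((h 0 (g 0)).mp rfl) id
  · have := ((h (1 - k) (g (1 - k))).mp rfl).1
    revert this; fin_cases k <;> simp
  · congr 1
    exact Equiv.ext fun a => ((h a (g a)).mp rfl).symm

theorem exists_act (R : Fin 2 → Fin 2 → Prop) (h₁ : ∀ a b c, R a b → R a c → b = c)
    (h₂ : ∀ a b c, R a c → R b c → a = b) : ∃ x : F7, ∀ a b, Act x a b ↔ R a b := by
  have h01 := h₁ 0 0 1
  have h02 := h₁ 1 0 1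
  have h03 := h₂ 0 1 0
  have h04 := h₂ 0 1 1
  by_cases h00 : R 0 0
  · by_cases h11 : R 1 1
    · exact ⟨grp 1, by simp_all [Fin.forall_fin_two, Act]⟩
    · exact ⟨rees 0 0, by simp_all [Fin.forall_fin_two, Act]⟩
  · by_cases h0 : R 0 1
    · by_cases h10 : R 1 0
      · exact ⟨grp (Equiv.swap 0 1), by simp_all [Fin.forall_fin_two, Act]⟩
      · exact ⟨rees 0 1, by simp_all [Fin.forall_fin_two, Act]⟩
    · by_cases h10 : R 1 0
      · exact ⟨rees 1 0, by simp_all [Fin.forall_fin_two, Act]⟩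
      · by_cases h11 : R 1 1
        · exact ⟨rees 1 1, by simp_all [Fin.forall_fin_two, Act]⟩
        · exact ⟨theta, by simp_all [Fin.forall_fin_two, Act]⟩

theorem surjective_of_mem_range {S : Type*} [Semigroup S] (f : S →ₙ* F7)
    (hu : ∃ s, f s = grp (Equiv.swap 0 1)) (he : ∃ s, f s = rees 0 0) : Function.Surjective f := by
  obtain ⟨u, hu⟩ := hu
  obtain ⟨e, he⟩ := he
  rintro (_ | ⟨i, j⟩ | g)
  · exact ⟨e * u * e, by rw [map_mul, map_mul, hu, he]; rfl⟩
  · fin_cases i <;> fin_cases j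
    · exact ⟨e, he⟩
    · exact ⟨e * u, by rw [map_mul, hu, he]; rfl⟩
    · exact ⟨u * e, by rw [map_mul, hu, he]; rfl⟩
    · exact ⟨u * e * u, by rw [map_mul, map_mul, hu, he]; rfl⟩
  · have : g = Equiv.swap 0 1 * Equiv.swap 0 1 ∨ g = Equiv.swap 0 1 := by
      revert g; decide
    rcases this with rfl | rfl
    · exact ⟨u * u, by rw [map_mul, hu]; rfl⟩
    · exact ⟨u, hu⟩

end F7

/-- In a block group `Moves` restricted to the two points is a partial injection. The subsemigroup
consists of the `s` that never send a point, while acting invertibly on it, outside the pair; this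
makes the action multiplicative. The image contains the swap, from `c`, and `rees 0 0`, from `pt 0`,
and these generate `F7`. -/
theorem f7_divides_of_moves {S : Type*} [Semigroup S] [Finite S]
    (hM : IsBlockGroup (WithOne S)) (pt : Fin 2 → WithOne S) (hne : pt 0 ≠ pt 1)
    (hid : ∀ a, pt a * pt a = pt a) (hJ : ∀ a b, ∃ u v, pt b = u * pt a * v) {c : WithOne S}
    (hc₀ : Moves (pt 0) c (pt 1)) (hc₁ : Moves (pt 1) c (pt 0)) : SemigroupDivides F7 S := by
  have hinj : Function.Injective pt := by
    intro a b
    fin_cases a <;> fin_cases b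
    · simp
    · exact fun h => absurd h hne
    · exact fun h => absurd h.symm hne
    · simp
  have : Finite (WithOne S) := inferInstanceAs (Finite (Option S))
  have hru : ∀ {a b b' s}, Moves (pt a) s (pt b) → Moves (pt a) s (pt b') → b = b' :=
    fun h h' => hinj (h.right_unique hM h' (hid _) (hid _) (hid _) (hJ _ _) (hJ _ _))
  have hli : ∀ {a a' b s}, Moves (pt a) s (pt b) → Moves (pt a') s (pt b) → a = a' :=
    fun h h' => hinj (h.left_injective hM h' (hid _) (hid _) (hid _) (hJ _ _) (hJ _ _))
  let U : Subsemigroup S :=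
    { carrier := {s | ∀ a, (∃ x, pt a * (s : WithOne S) * x = pt a) →
        ∃ b, Moves (pt a) (s : WithOne S) (pt b)}
      mul_mem' := by
        intro s t hs ht a ⟨x, hx⟩
        rw [WithOne.coe_mul] at hx ⊢
        obtain ⟨b, hb⟩ := hs a ⟨t * x, by simpa only [mul_assoc] using hx⟩
        obtain ⟨d, hd⟩ := ht b ⟨_, hb.exists_mul_eq hx (hid a) (hid b) (hJ a b)⟩
        exact ⟨d, hb.comp hd⟩ }
  have hU : ∀ s : U, ∃ x : F7, ∀ a b, F7.Act x a b ↔ Moves (pt a) ((s : S) : WithOne S) (pt b) :=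
    fun s => F7.exists_act _ (fun a b c h h' => hru h h') (fun a b c h h' => hli h h')
  choose f hf using hU
  let F : U →ₙ* F7 :=
    { toFun := f
      map_mul' := by
        intro s t
        refine F7.act_injective fun a b => ?_
        rw [hf, F7.act_mul, MulMemClass.coe_mul, WithOne.coe_mul]
        constructor
        · intro h
          obtain ⟨d, hd⟩ := s.2 a (h.2.imp' (fun x => t * x)
            (fun x hx => by simpa only [mul_assoc] using hx))
          exact ⟨d, (hf _ _ _).mpr hd, (hf _ _ _).mpr (hd.cancel h (hid _) (hid _) (hJ _ _))⟩
        · rintro ⟨d, h1, h2⟩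
          exact ((hf _ _ _).mp h1).comp ((hf _ _ _).mp h2) }
  have hc1 : c ≠ 1 := by
    rintro rfl
    have h1 : Moves (pt 0) 1 (pt 0) := ⟨by simp [hid], 1, by simp⟩
    exact absurd (hru hc₀ h1) (by simp)
  obtain ⟨c, rfl⟩ := WithOne.ne_one_iff_exists.mp hc1
  have he1 : pt 0 ≠ 1 := by
    intro h
    obtain ⟨x, hx⟩ := hc₀.2
    rw [h, one_mul] at hx
    rcases eq_or_ne x 1 with rfl | hx1
    · simp at hx
    · obtain ⟨x, rfl⟩ := WithOne.ne_one_iff_exists.mp hx1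
      exact WithOne.coe_ne_one hx
  obtain ⟨e, he⟩ := WithOne.ne_one_iff_exists.mp he1
  have hcs : ∀ a, Moves (pt a) (c : WithOne S) (pt (Equiv.swap 0 1 a)) := by
    intro a
    fin_cases a
    · exact hc₀
    · exact hc₁
  have hee : Moves (pt 0) (pt 0) (pt 0) := ⟨by simp [hid], 1, by simp [hid]⟩
  have hfe : ∀ a, (∃ x, pt a * pt 0 * x = pt a) → Moves (pt a) (pt 0) (pt 0) :=
    fun a h => ⟨by rw [mul_assoc, hid], h⟩
  refine ⟨U, F, F7.surjective_of_mem_range F ⟨⟨c, fun a _ => ⟨_, hcs a⟩⟩, ?_⟩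
    ⟨⟨e, fun a h => ⟨0, by rw [he] at h ⊢; exact hfe a h⟩⟩, ?_⟩⟩
  · refine F7.act_injective fun a b => (hf _ _ _).trans ⟨fun h => hru (hcs a) h, ?_⟩
    rintro rfl
    exact hcs a
  · refine F7.act_injective fun a b => (hf _ _ _).trans ?_
    simp only [he]
    constructor
    · intro h
      obtain rfl := hru h (hfe a h.2)
      exact ⟨hli h hee, rfl⟩
    · rintro ⟨rfl, rfl⟩
      exact hee

/-! ### The maximal subgroup at an idempotent -/

/-- The local monoid `eMe` at an idempotent `e`. -/
def LocalMonoid {M : Type*} [Monoid M] (e : M) (_ : e * e = e) : Type _ :=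
  {x : M // e * x = x ∧ x * e = x}

namespace LocalMonoid

variable {M : Type*} [Monoid M] {e : M} {he : e * e = e}

instance : Monoid (LocalMonoid e he) where
  mul x y := ⟨x.1 * y.1, by rw [← mul_assoc, x.2.1], by rw [mul_assoc, y.2.2]⟩
  one := ⟨e, he, he⟩
  mul_assoc x y z := Subtype.ext (mul_assoc x.1 y.1 z.1)
  one_mul x := Subtype.ext x.2.1
  mul_one x := Subtype.ext x.2.2

instance [Finite M] : Finite (LocalMonoid e he) :=
  inferInstanceAs (Finite {x : M // e * x = x ∧ x * e = x})

/-- The element of `M` underlying a unit of `eMe`. -/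
def val (x : (LocalMonoid e he)ˣ) : M := x.1.1

theorem val_mul (x y : (LocalMonoid e he)ˣ) : val (x * y) = val x * val y := rfl

theorem val_one : val (1 : (LocalMonoid e he)ˣ) = e := rfl

theorem mul_val (x : (LocalMonoid e he)ˣ) : e * val x = val x := x.1.2.1

theorem val_mul_idem (x : (LocalMonoid e he)ˣ) : val x * e = val x := x.1.2.2

theorem val_injective : Function.Injective (val : (LocalMonoid e he)ˣ → M) :=
  fun _ _ h => Units.ext (Subtype.ext h)

theorem exists_val_eq [Finite M] {x y : M} (hx : e * x = x) (hx' : x * e = x) (hy : x * y = e) :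
    ∃ u : (LocalMonoid e he)ˣ, val u = x := by
  let X : LocalMonoid e he := ⟨x, hx, hx'⟩
  let Y : LocalMonoid e he := ⟨e * y * e, by rw [← mul_assoc, ← mul_assoc, he], by
    rw [mul_assoc, he]⟩
  have hXY : X * Y = 1 := Subtype.ext (by
    change x * (e * y * e) = e
    rw [← mul_assoc, ← mul_assoc, hx', hy, he])
  exact ⟨⟨X, Y, hXY, mul_eq_one_symm hXY⟩, rfl⟩

end LocalMonoid

theorem WithOne.isBlockGroup {S : Type*} [Semigroup S] (h : IsBlockGroup S) :
    IsBlockGroup (WithOne S) := by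
  intro a b c ⟨hb, hb'⟩ ⟨hc, hc'⟩
  rcases eq_or_ne a 1 with rfl | ha
  · rw [one_mul, mul_one] at hb hc
    rw [hb, hc]
  · obtain ⟨a, rfl⟩ := WithOne.ne_one_iff_exists.mp ha
    have key : ∀ b : WithOne S, b * a * b = b → ∃ b' : S, (b' : WithOne S) = b := by
      intro b hb
      refine WithOne.ne_one_iff_exists.mp ?_
      rintro rfl
      simp at hb
    obtain ⟨b, rfl⟩ := key b hb'
    obtain ⟨c, rfl⟩ := key c hc'
    simp only [← WithOne.coe_mul, WithOne.coe_inj] at hb hb' hc hc'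
    exact congrArg _ (h a b c ⟨hb, hb'⟩ ⟨hc, hc'⟩)

theorem isNilpotent_units_localMonoid {S : Type*} [Semigroup S] (h : IsBGnil S) {e : WithOne S}
    (he : e * e = e) (he1 : e ≠ 1) : Group.IsNilpotent (LocalMonoid e he)ˣ := by
  have hv : ∀ x : (LocalMonoid e he)ˣ, LocalMonoid.val x ≠ 1 := by
    intro x hx
    have := LocalMonoid.mul_val x
    rw [hx, mul_one] at this
    exact he1 this
  refine h.2.2 _
    { toFun := fun x => WithOne.unone (hv x)
      map_mul' := fun x y => WithOne.coe_injective (by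
        simp only [WithOne.coe_mul, WithOne.coe_unone, LocalMonoid.val_mul]) } ?_
  intro x y hxy
  have := congrArg (fun s : S => (s : WithOne S)) hxy
  simp only [MulHom.coe_mk, WithOne.coe_unone] at this
  exact LocalMonoid.val_injective this

/-! ### Recurrent Mal'cev sequences -/

section Recurrent

/-- A recurrent pair of sequences `A_{n+1} = A_n w_n B_n`, `B_{n+1} = B_n w_n A_n`. -/
structure MalcevCycle {M : Type*} [Monoid M] (A B w : ℕ → M) : Prop where
  fst_succ : ∀ n, A (n + 1) = A n * w n * B n
  snd_succ : ∀ n, B (n + 1) = B n * w n * A n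
  periodic : ∃ P, 0 < P ∧ ∀ n, A (n + P) = A n ∧ B (n + P) = B n

variable {M : Type*} [Monoid M] {A B w : ℕ → M}

theorem MalcevCycle.symm (h : MalcevCycle A B w) : MalcevCycle B A w :=
  ⟨h.snd_succ, h.fst_succ, h.periodic.imp fun _ hP => ⟨hP.1, fun n => (hP.2 n).symm⟩⟩

/-- Every second term `A (n + 2k)`, `k ≥ 1`, begins with `A n * w n * B n` and ends with `B n * w n
* A n`; going twice around the period returns to `A n`. -/
theorem MalcevCycle.exists_regular (h : MalcevCycle A B w) (n : ℕ) :
    ∃ Q, A n * (w n * B n * Q * B n * w n) * A n = A n := by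
  have key : ∀ k n, ∃ Q, A (n + 2 * (k + 1)) = A n * (w n * B n * Q * B n * w n) * A n := by
    intro k
    induction k with
    | zero =>
      intro n
      refine ⟨w (n + 1), ?_⟩
      rw [show n + 2 * (0 + 1) = n + 1 + 1 by ring, h.fst_succ (n + 1), h.fst_succ n, h.snd_succ n]
      simp only [mul_assoc]
    | succ k ih =>
      intro n
      obtain ⟨Q, hQ⟩ := ih n
      refine ⟨Q * B n * w n * A n * (w (n + 2 * (k + 1)) * B (n + 2 * (k + 1)) *
        w (n + 2 * (k + 1) + 1) * B (n + 2 * (k + 1)) * w (n + 2 * (k + 1))) * A n * w n * B n * Q,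
        ?_⟩
      rw [show n + 2 * (k + 1 + 1) = n + 2 * (k + 1) + 1 + 1 by ring, h.fst_succ (_ + 1),
        h.fst_succ (n + 2 * (k + 1)), h.snd_succ (n + 2 * (k + 1)), hQ]
      simp only [mul_assoc]
  obtain ⟨P, hP, hper⟩ := h.periodic
  obtain ⟨k, rfl⟩ := Nat.exists_eq_succ_of_ne_zero hP.ne'
  obtain ⟨Q, hQ⟩ := key k n
  refine ⟨Q, ?_⟩
  rw [← hQ, two_mul, ← add_assoc, (hper _).1, (hper _).1]

/-- A choice of a middle factor `V` such that `A V A = A` for `A` in a recurrent pair. -/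
noncomputable def MalcevCycle.mid (h : MalcevCycle A B w) (n : ℕ) : M :=
  w n * B n * (h.exists_regular n).choose * B n * w n

theorem MalcevCycle.mid_eq (h : MalcevCycle A B w) (n : ℕ) :
    ∃ Q, h.mid n = w n * B n * Q * B n * w n := ⟨_, rfl⟩

theorem MalcevCycle.mul_mid_mul (h : MalcevCycle A B w) (n : ℕ) : A n * h.mid n * A n = A n :=
  (h.exists_regular n).choose_spec

theorem MalcevCycle.left_idem (h : MalcevCycle A B w) (n : ℕ) :
    A n * h.mid n * (A n * h.mid n) = A n * h.mid n := by
  rw [← mul_assoc, h.mul_mid_mul]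

theorem MalcevCycle.right_idem (h : MalcevCycle A B w) (n : ℕ) :
    h.mid n * A n * (h.mid n * A n) = h.mid n * A n := by
  rw [mul_assoc, ← mul_assoc (A n), h.mul_mid_mul]

/-- `A (n + 1)` begins with `A n`, and by regularity `A n` is a right multiple of `A (n + 1)`; the
left idempotents generate the same right ideal, so they agree in a block group. Dually, `A (n + 1)`
and `B n` share their right idempotent. -/
theorem MalcevCycle.left_succ (h : MalcevCycle A B w) (hM : IsBlockGroup M) (n : ℕ) :
    A (n + 1) * h.mid (n + 1) = A n * h.mid n := by
  refine hM.eq_of_right_zero (h.left_idem _) ?_ ?_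
  · obtain ⟨Q, hQ⟩ := h.mid_eq n
    have h1 : A n = A (n + 1) * (Q * B n * w n * A n) := by
      conv_lhs => rw [← h.mul_mid_mul n, hQ]
      rw [h.fst_succ]
      simp only [mul_assoc]
    rw [h1, ← mul_assoc, ← mul_assoc, h.mul_mid_mul]
  · rw [h.fst_succ n, ← mul_assoc, ← mul_assoc, ← mul_assoc, h.mul_mid_mul]

theorem MalcevCycle.right_succ (h : MalcevCycle A B w) (hM : IsBlockGroup M) (n : ℕ) :
    h.mid (n + 1) * A (n + 1) = h.symm.mid n * B n := by
  refine hM.eq_of_left_zero (h.right_idem _) (h.symm.right_idem _) ?_ ?_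
  · rw [h.fst_succ n]
    simp only [mul_assoc]
    rw [← mul_assoc (B n), h.symm.mul_mid_mul]
  · obtain ⟨Q, hQ⟩ := h.symm.mid_eq n
    have h1 : B n = B n * w n * A n * Q * (A (n + 1)) := by
      conv_lhs => rw [← h.symm.mul_mid_mul n, hQ]
      rw [h.fst_succ]
      simp only [mul_assoc]
    have h2 : B n * (h.mid (n + 1) * A (n + 1)) = B n := by
      rw [h1]
      rw [mul_assoc _ (A (n + 1)), ← mul_assoc (A (n + 1)), h.mul_mid_mul]
    rw [mul_assoc, h2]

theorem MalcevCycle.exists_left_eq (h : MalcevCycle A B w) (n : ℕ) :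
    ∃ u v, B n * h.symm.mid n = u * (A n * h.mid n) * v := by
  obtain ⟨Q, hQ⟩ := h.symm.mid_eq n
  refine ⟨B n * w n, A n * Q * A n * w n, ?_⟩
  calc B n * h.symm.mid n = B n * w n * A n * Q * A n * w n := by rw [hQ]; simp only [mul_assoc]
    _ = B n * w n * (A n * h.mid n * A n) * Q * A n * w n := by rw [h.mul_mid_mul]
    _ = _ := by simp only [mul_assoc]

theorem MalcevCycle.exists_left_eq_right (h : MalcevCycle A B w) (n : ℕ) :
    ∃ u v, B n * h.symm.mid n = u * (h.mid n * A n) * v := by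
  obtain ⟨Q, hQ⟩ := h.symm.mid_eq n
  refine ⟨B n * w n * A n, Q * A n * w n, ?_⟩
  calc B n * h.symm.mid n = B n * w n * A n * Q * A n * w n := by rw [hQ]; simp only [mul_assoc]
    _ = B n * w n * (A n * h.mid n * A n) * Q * A n * w n := by rw [h.mul_mid_mul]
    _ = _ := by simp only [mul_assoc]

theorem MalcevCycle.moves [Finite M] (h : MalcevCycle A B w) (hM : IsBlockGroup M) (n : ℕ) :
    Moves (h.mid n * A n) (w n) (B n * h.symm.mid n) := by
  obtain ⟨Q, hQ⟩ := h.mid_eq n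
  refine Moves.of_mul_eq hM (x := B n * Q * B n * w n * A n) ?_ (h.right_idem n)
    (h.symm.left_idem n) (h.exists_left_eq_right n)
  have h1 : B n * h.symm.mid n * B n = B n := h.symm.mul_mid_mul n
  calc h.mid n * A n * w n * (B n * h.symm.mid n) * (B n * Q * B n * w n * A n)
      = h.mid n * A n * w n * (B n * h.symm.mid n * B n) * Q * B n * w n * A n := by
        simp only [mul_assoc]
    _ = h.mid n * (A n * (w n * B n * Q * B n * w n) * A n) := by
        rw [h1]; simp only [mul_assoc]
    _ = h.mid n * A n := by rw [← hQ, h.mul_mid_mul]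

end Recurrent

/-! ### The main theorem -/

theorem exists_periodic_of_finite {X : Type*} [Finite X] (F : X → X) {f : ℕ → X}
    (hf : ∀ n, f (n + 1) = F (f n)) : ∃ i P, 0 < P ∧ ∀ n, f (i + n + P) = f (i + n) := by
  have key : ∀ i j, i < j → f i = f j → ∃ i P, 0 < P ∧ ∀ n, f (i + n + P) = f (i + n) := by
    intro i j hij hfij
    refine ⟨i, j - i, by omega, fun n => ?_⟩
    induction n with
    | zero => rw [add_zero, Nat.add_sub_cancel' hij.le, hfij]
    | succ n ih =>
      rw [← add_assoc, add_right_comm, hf, ih, hf]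
  obtain ⟨i, j, hij, h⟩ := Finite.exists_ne_map_eq_of_infinite f
  rcases lt_or_gt_of_ne hij with h' | h'
  · exact key i j h' h
  · exact key j i h' h.symm

theorem exists_malcevCycle {M : Type*} [Monoid M] [Finite M] (a b c : M) :
    ∃ i, MalcevCycle (fun n => (malcevPair a b (engelParam c) (i + n + 2)).1)
      (fun n => (malcevPair a b (engelParam c) (i + n + 2)).2) (fun n => c ^ (i + 1 + n)) := by
  -- Carrying the next parameter `c ^ (n + 1)` in the state makes the recursion autonomous; the
  -- shift by 2 skips the two initial parameters 1.
  obtain ⟨i, P, hP, hper⟩ := exists_periodic_of_finite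
    (f := fun n => (malcevPair a b (engelParam c) (n + 2), c ^ (n + 1)))
    (fun x : (M × M) × M => ((x.1.1 * x.2 * x.1.2, x.1.2 * x.2 * x.1.1), x.2 * c))
    (fun n => by simp [malcevPair, engelParam, pow_succ])
  refine ⟨i, fun n => ?_, fun n => ?_, P, hP, fun n => ?_⟩
  · rw [show i + (n + 1) + 2 = i + n + 2 + 1 by ring, malcevPair, engelParam]
    simp only
    rw [show i + n + 1 = i + 1 + n by ring]
  · rw [show i + (n + 1) + 2 = i + n + 2 + 1 by ring, malcevPair, engelParam]
    simp only
    rw [show i + n + 1 = i + 1 + n by ring]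
  · have := congrArg Prod.fst (hper n)
    simp only at this
    rw [← add_assoc, this]
    exact ⟨rfl, rfl⟩

theorem MalcevCycle.exists_eq_of_group {M : Type*} [Monoid M] [Finite M] {A B : ℕ → M} {c : M}
    {m : ℕ} (h : MalcevCycle A B (fun n => c ^ (m + n))) {e : M} (he : e * e = e)
    (hG : Group.IsNilpotent (LocalMonoid e he)ˣ) (hc : Moves e c e)
    (hA : A 0 * h.mid 0 = e) (hA' : h.mid 0 * A 0 = e)
    (hB : B 0 * h.symm.mid 0 = e) (hB' : h.symm.mid 0 * B 0 = e) : ∃ n, A n = B n := by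
  obtain ⟨a, ha⟩ : ∃ a : (LocalMonoid e he)ˣ, LocalMonoid.val a = A 0 :=
    LocalMonoid.exists_val_eq (by rw [← hA, h.mul_mid_mul])
      (by rw [← hA', ← mul_assoc, h.mul_mid_mul]) hA
  obtain ⟨b, hb⟩ : ∃ b : (LocalMonoid e he)ˣ, LocalMonoid.val b = B 0 :=
    LocalMonoid.exists_val_eq (by rw [← hB, h.symm.mul_mid_mul])
      (by rw [← hB', ← mul_assoc, h.symm.mul_mid_mul]) hB
  obtain ⟨x, hx⟩ := hc.2
  obtain ⟨g, hg⟩ : ∃ g : (LocalMonoid e he)ˣ, LocalMonoid.val g = e * c :=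
    LocalMonoid.exists_val_eq (y := x) (by rw [← mul_assoc, he]) hc.1 hx
  have hpow : ∀ k, LocalMonoid.val (g ^ k) = e * c ^ k := by
    intro k
    induction k with
    | zero => rw [pow_zero, pow_zero, mul_one, LocalMonoid.val_one]
    | succ k ih =>
      rw [pow_succ', LocalMonoid.val_mul, ih, hg, pow_succ', ← mul_assoc, hc.1, mul_assoc]
  obtain ⟨n, hn⟩ := hG.exists_malcevPair_eq
  -- Shifted by one because step `k` of `malcevPair` uses `z (k + 1)`, which must be `g ^ (m + k)`;
  -- `z 0` is never used.
  let z : ℕ → (LocalMonoid e he)ˣ := fun k => g ^ (m + k - 1)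
  have key : ∀ k, LocalMonoid.val (malcevPair a b z k).1 = A k ∧
      LocalMonoid.val (malcevPair a b z k).2 = B k := by
    intro k
    induction k with
    | zero => exact ⟨ha, hb⟩
    | succ k ih =>
      have hz : z (k + 1) = g ^ (m + k) := rfl
      simp only [malcevPair, LocalMonoid.val_mul, hz, hpow, ← mul_assoc,
        LocalMonoid.val_mul_idem]
      rw [ih.1, ih.2, h.fst_succ, h.snd_succ]
      exact ⟨rfl, rfl⟩
  exact ⟨n, by rw [← (key n).1, ← (key n).2, hn]⟩

theorem MalcevCycle.exists_eq {S : Type*} [Semigroup S] [Finite S] (hS : IsBGnil S)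
    (hF : ¬ SemigroupDivides F7 S) {A B : ℕ → WithOne S} {c : WithOne S} {m : ℕ}
    (h : MalcevCycle A B (fun n => c ^ (m + n))) : ∃ n, A n = B n := by
  have hM : IsBlockGroup (WithOne S) := WithOne.isBlockGroup hS.2.1
  have : Finite (WithOne S) := inferInstanceAs (Finite (Option S))
  have hi := h.left_idem 0
  have hk := h.symm.left_idem 0
  have hj := h.right_idem 0
  have hl := h.symm.right_idem 0
  have m1 := h.moves hM 0
  have m2 := h.symm.moves hM 0
  have m3 := h.moves hM 1
  have m4 := h.symm.moves hM 1
  have hw : c ^ (m + 1) = c ^ (m + 0) * c := pow_succ c m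
  rw [h.right_succ hM 0, h.symm.left_succ hM 0, hw] at m3
  rw [h.symm.right_succ hM 0, h.left_succ hM 0, hw] at m4
  -- With `j`, `l` the right idempotents of `A 0`, `B 0`: `c ^ m` sends `j` to `k` and `c ^ (m + 1)`
  -- sends `j` to `i`, so `c` sends `k` to `i`. Starting from `l` gives the reverse.
  have hcki := m1.cancel m4 hj hk (h.exists_left_eq_right 0)
  have hcik := m2.cancel m3 hl hi (h.symm.exists_left_eq_right 0)
  have hJ := h.exists_left_eq 0
  have hJ' := h.symm.exists_left_eq 0
  have hJr := h.exists_left_eq_right 0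
  have hJr' := h.symm.exists_left_eq_right 0
  by_cases hik : A 0 * h.mid 0 = B 0 * h.symm.mid 0
  · rw [← hik] at hcki m1 hJr
    have hcm := hcki.pow hi (m + 0)
    have hJi : ∃ u v, A 0 * h.mid 0 = u * (A 0 * h.mid 0) * v := ⟨1, 1, by simp⟩
    have hji := m1.left_injective hM hcm hj hi hi hJr hJi
    have hli := m2.left_injective hM hcm hl hi hi hJr' hJi
    -- Nilpotency is known only for subgroups of `S`, so the adjoined identity is treated apart: it
    -- factors only trivially, whence `A 0 = B 0 = 1`.
    by_cases h1 : A 0 * h.mid 0 = 1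
    · have hone : ∀ x y : WithOne S, x * y = 1 → x = 1 := by
        intro x y hxy
        by_contra hx
        obtain ⟨x, rfl⟩ := WithOne.ne_one_iff_exists.mp hx
        rcases eq_or_ne y 1 with rfl | hy
        · simp at hxy
        · obtain ⟨y, rfl⟩ := WithOne.ne_one_iff_exists.mp hy
          exact WithOne.coe_ne_one hxy
      exact ⟨0, (hone _ _ h1).trans (hone _ _ (hik.symm.trans h1)).symm⟩
    · exact h.exists_eq_of_group hi (isNilpotent_units_localMonoid hS hi h1) hcki rfl hji
        hik.symm hli
  · exfalso
    apply hF
    refine f7_divides_of_moves hM ![A 0 * h.mid 0, B 0 * h.symm.mid 0] hik ?_ ?_ hcik hcki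
    · rw [Fin.forall_fin_two]
      exact ⟨hi, hk⟩
    · simp only [Fin.forall_fin_two]
      exact ⟨⟨⟨1, 1, by simp⟩, hJ⟩, hJ', ⟨1, 1, by simp⟩⟩

theorem isPositivelyEngel_of_isBGnil {S : Type*} [Semigroup S] [Finite S] (hS : IsBGnil S)
    (hF : ¬ SemigroupDivides F7 S) : IsPositivelyEngel S := by
  have : Finite (WithOne S) := inferInstanceAs (Finite (Option S))
  rw [isPositivelyEngel_iff]
  by_contra! hne
  have hfail : ∀ n : ℕ, ∃ t : S × S × WithOne S,
      (malcevPair (t.1 : WithOne S) (t.2.1 : WithOne S) (engelParam t.2.2) (n + 2)).1 ≠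
        (malcevPair (t.1 : WithOne S) (t.2.1 : WithOne S) (engelParam t.2.2) (n + 2)).2 := by
    intro n
    have := hne (n + 2) (by omega)
    simp only [SatisfiesEngel, not_forall] at this
    obtain ⟨a, b, c, h⟩ := this
    exact ⟨(a, b, c), h⟩
  choose t ht using hfail
  -- By pigeonhole one triple fails for infinitely many `n`, whereas a single equality persists for
  -- all larger `n`.
  obtain ⟨⟨a, b, c⟩, hinf⟩ := Finite.exists_infinite_fiber t
  obtain ⟨i, hcyc⟩ := exists_malcevCycle (a : WithOne S) (b : WithOne S) c
  obtain ⟨n, hn⟩ := hcyc.exists_eq hS hF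
  obtain ⟨k, hk, hlt⟩ := (Set.infinite_coe_iff.mp hinf).exists_gt (i + n)
  have h1 := ht k
  rw [show t k = (a, b, c) from hk] at h1
  exact h1 (malcevPair_fst_eq_snd_of_le (by omega) hn)

theorem mainTheorem10 (S : Type*) [Semigroup S] [Finite S] :
    IsPositivelyEngel S ↔ (IsBGnil S ∧ ¬ SemigroupDivides F7 S) := by
  constructor
  · intro h
    obtain ⟨n, -, hn⟩ := isPositivelyEngel_iff.mp h
    refine ⟨⟨inferInstance, hn.isBlockGroup, fun G _ f hf => ?_⟩,
      fun hd => F7.not_satisfiesEngel n (hn.of_divides hd)⟩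
    have : Finite G := Finite.of_injective f hf
    exact (hn.of_injective f hf).isNilpotent
  · rintro ⟨hS, hF⟩
    exact isPositivelyEngel_of_isBGnil hS hF
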